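/- Points of the unit sphere $\mathcal S\subset\mathbb R^3$ are given in spherical coordinates $x=(\vartheta,\varphi)\in[0,\pi]\times[0,2\pi)$. For $l\in\mathbb N_0$ let $P_l$ be the Legendre polynomial, $P_l^m(t)=(1-t^2)^{m/2}\frac{d^m}{dt^m}P_l(t)$ for $0\le m\le l$, and $$Y_l^m(\vartheta,\varphi)=(-1)^m\sqrt{\frac{2l+1}{4\pi}\frac{(l-m)!}{(l+m)!}}\,P_l^m(\cos\vartheta)\,e^{im\varphi}\quad(0\le m\le l),\qquad Y_l^m=\overline{Y_l^{-m}}\quad(-l\le m<0).$$ On functions ${}_sf$ of spin weight $s\in\mathbb Z$ let $$\eth\,{}_sf=-\Bigl(\partial_\vartheta+\frac{i}{\sin\vartheta}\partial_\varphi-s\cot\vartheta\Bigr){}_sf,\qquad \bar\eth\,{}_sf=-\Bigl(\partial_\vartheta-\frac{i}{\sin\vartheta}\partial_\varphi+s\cot\vartheta\Bigr){}_sf,$$ so that $\eth$ raises and $\bar\eth$ lowers the spin weight by one; $Y_l^m$ has spin weight $0$. The spin weighted spherical harmonics are $${}_sY_l^m=\sqrt{\frac{(l-s)!}{(l+s)!}}\,\eth^sY_l^m\quad(0\le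 s\le l),\qquad {}_sY_l^m=\sqrt{\frac{(l+s)!}{(l-s)!}}\,(-1)^s\,\bar\eth^{-s}Y_l^m\quad(-l\le s\le 0)$$ for $0<\vartheta<\pi$, extended to $\vartheta\in\{0,\pi\}$ by the limit in $\vartheta$ with $\varphi$ fixed. For $|s|\le l$ put $${}_s\mathcal K_l(x,y)=\sum_{m=-l}^{l}{}_sY_l^m(x)\,\overline{{}_sY_l^m(y)}.$$ Proposition. There is a constant $C>0$ such that for all $s\in\mathbb Z$, all integers $l\ge 1$ with $l\ge|s|$, and all $x,y\in[0,\pi]\times[0,2\pi)$, $$\left|{}_s\mathcal K_l(x,y)\right|\le C\cdot l^{2|s|+1}.$$ -/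

import Mathlib

open scoped ComplexConjugate

noncomputable section

/-- Spherical coordinates `(ϑ, φ) ∈ [0, π] × [0, 2π)` of the points of the unit sphere. -/
def sphereCoords : Set (ℝ × ℝ) :=
  Set.Icc 0 Real.pi ×ˢ Set.Ico 0 (2 * Real.pi)

/-- The Legendre polynomial `P_l` (Rodrigues' formula). -/
def legendrePoly (l : ℕ) : Polynomial ℝ :=
  Polynomial.C (1 / (2 ^ l * (l.factorial : ℝ))) *
    (Polynomial.derivative^[l] ((Polynomial.X ^ 2 - 1) ^ l))

/-- The associated Legendre function `P_l^m(t) = (1 - t²)^{m/2} (d/dt)^m P_l(t)`, `m ≥ 0`,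
`t ∈ [-1, 1]`. -/
def assocLegendre (l m : ℕ) (t : ℝ) : ℝ :=
  Real.sqrt (1 - t ^ 2) ^ m * (Polynomial.derivative^[m] (legendrePoly l)).eval t

/-- The spherical harmonic `Y_l^m` for `0 ≤ m ≤ l`, as a function of `ϑ` and `φ`. -/
def sphericalHarmonicNonneg (l m : ℕ) (ϑ φ : ℝ) : ℂ :=
  (-1) ^ m *
    (Real.sqrt ((2 * l + 1) / (4 * Real.pi) * ((l - m).factorial / (l + m).factorial)) : ℂ) *
    (assocLegendre l m (Real.cos ϑ) : ℂ) * Complex.exp (Complex.I * m * φ)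

/-- The spherical harmonic `Y_l^m` for `-l ≤ m ≤ l`; for `m < 0` it is the complex conjugate
of `Y_l^{-m}`. -/
def sphericalHarmonic (l : ℕ) (m : ℤ) (ϑ φ : ℝ) : ℂ :=
  if 0 ≤ m then sphericalHarmonicNonneg l m.toNat ϑ φ
  else conj (sphericalHarmonicNonneg l (-m).toNat ϑ φ)

/-- The spin-raising operator `ð` on functions of spin weight `s`, away from the poles:
`ð f = -(∂_ϑ + (i / sin ϑ) ∂_φ - s cot ϑ) f`. -/
def eth (s : ℤ) (f : ℝ → ℝ → ℂ) (ϑ φ : ℝ) : ℂ :=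
  -(deriv (fun t => f t φ) ϑ + Complex.I / (Real.sin ϑ : ℂ) * deriv (fun p => f ϑ p) φ
    - s * (Real.cot ϑ : ℂ) * f ϑ φ)

/-- The spin-lowering operator `ð̄` on functions of spin weight `s`, away from the poles:
`ð̄ f = -(∂_ϑ - (i / sin ϑ) ∂_φ + s cot ϑ) f`. -/
def ethBar (s : ℤ) (f : ℝ → ℝ → ℂ) (ϑ φ : ℝ) : ℂ :=
  -(deriv (fun t => f t φ) ϑ - Complex.I / (Real.sin ϑ : ℂ) * deriv (fun p => f ϑ p) φ
    + s * (Real.cot ϑ : ℂ) * f ϑ φ)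

/-- `ð^n` applied to a function of spin weight `0`: the `(k+1)`-st application of `ð` acts on a
function of spin weight `k`. -/
def ethPow : ℕ → (ℝ → ℝ → ℂ) → ℝ → ℝ → ℂ
  | 0, f => f
  | n + 1, f => eth (n : ℤ) (ethPow n f)

/-- `ð̄^n` applied to a function of spin weight `0`: the `(k+1)`-st application of `ð̄` acts on a
function of spin weight `-k`. -/
def ethBarPow : ℕ → (ℝ → ℝ → ℂ) → ℝ → ℝ → ℂ
  | 0, f => f
  | n + 1, f => ethBar (-(n : ℤ)) (ethBarPow n f)

/-- The spin weighted spherical harmonic `ₛY_l^m` away from the poles, for `|s| ≤ l`: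
`√((l-s)!/(l+s)!) ð^s Y_l^m` for `s ≥ 0` and `√((l+s)!/(l-s)!) (-1)^s ð̄^{-s} Y_l^m` for `s < 0`
(both definitions give `Y_l^m` for `s = 0`). -/
def spinHarmonicInterior (s : ℤ) (l : ℕ) (m : ℤ) (ϑ φ : ℝ) : ℂ :=
  if 0 ≤ s then
    (Real.sqrt ((l - s.toNat).factorial / (l + s.toNat).factorial) : ℂ) *
      ethPow s.toNat (sphericalHarmonic l m) ϑ φ
  else
    (Real.sqrt ((l - (-s).toNat).factorial / (l + (-s).toNat).factorial) : ℂ) *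
      (-1) ^ (-s).toNat * ethBarPow (-s).toNat (sphericalHarmonic l m) ϑ φ

/-- The spin weighted spherical harmonic `ₛY_l^m` at `x = (ϑ, φ)`. At the poles `ϑ = 0` and
`ϑ = π`, where the coordinate expressions of `ð` and `ð̄` are singular, its value is the limit
along the meridian of longitude `φ`. -/
def spinHarmonic (s : ℤ) (l : ℕ) (m : ℤ) (x : ℝ × ℝ) : ℂ :=
  open Classical in
  if x.1 ∈ Set.Ioo 0 Real.pi then spinHarmonicInterior s l m x.1 x.2
  else extendFrom (Set.Ioo 0 Real.pi) (fun t => spinHarmonicInterior s l m t x.2) x.1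

/-- The kernel `ₛK_l(x, y) = ∑_{m=-l}^{l} ₛY_l^m(x) · conj (ₛY_l^m(y))`. -/
def spinKernel (s : ℤ) (l : ℕ) (x y : ℝ × ℝ) : ℂ :=
  ∑ m ∈ Finset.Icc (-(l : ℤ)) (l : ℤ), spinHarmonic s l m x * conj (spinHarmonic s l m y)

end

/-! Since 2ab ≤ a² + b², it suffices to bound the diagonal sums of |ₛY_l^m(x)|² over m.

Each ð^n Y_l^m is a phase times a real profile p_m(ϑ). Neighbouring profiles obey two ladder
relations: their weighted difference is p_m', and their weighted sum is a multiple of p_m. These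
come from the differentiated Legendre equation for n = 0 and persist under ð (`spinProfile_ladder`).
Squaring both and summing over m gives the exact identity `sum_sq_deriv_add_sq_spinProfile`. As ð is
the sum of the two kinds of term in it, one application multiplies the diagonal sum by at most
2(l(l+1) - n²), while normalization divides it by (l-n)(l+n+1): a net factor of at most 4. For n = 0
the sum is constant in ϑ, with its value read off at ϑ = 0. Hence the bound 4^n l.

The same identity bounds p_m', so the profiles extend continuously to the poles. Negative s reduces
to positive s by conjugation. -/

noncomputable section

/-! ### Derivatives of Legendre polynomials -/

open Polynomial in
/-- The `n`-times differentiated equation satisfied by `(X² - 1)^l`. -/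
theorem iterate_derivative_sq_sub_one_pow (l n : ℕ) :
    (X ^ 2 - 1 : ℝ[X]) * derivative^[n + 2] ((X ^ 2 - 1) ^ l)
      + C (2 * ((n : ℝ) + 1 - l)) * X * derivative^[n + 1] ((X ^ 2 - 1) ^ l)
      = C (((n : ℝ) + 1) * (2 * l - n)) * derivative^[n] ((X ^ 2 - 1) ^ l) := by
  induction n with
  | zero =>
    have h1 : (X ^ 2 - 1 : ℝ[X]) * derivative ((X ^ 2 - 1) ^ l)
        = C (2 * (l : ℝ)) * X * (X ^ 2 - 1) ^ l := by
      rcases l with _ | l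
      · simp
      · rw [derivative_pow_succ]
        simp only [derivative_sub, derivative_X_pow, derivative_one, map_mul, map_add,
          C_ofNat, Nat.cast_ofNat, Nat.cast_add, Nat.cast_one, map_one, C_eq_natCast]
        ring
    have h2 := congrArg derivative h1
    simp only [derivative_mul, derivative_sub, derivative_X_pow, derivative_one, derivative_C,
      derivative_X, derivative_ofNat, Nat.cast_ofNat, C_ofNat, map_mul] at h2
    simp only [Function.iterate_succ_apply', Function.iterate_zero, id, map_mul, map_sub,
      map_one, C_ofNat, Nat.cast_zero, map_zero, zero_add]
    linear_combination h2
  | succ n ih =>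
    have h2 := congrArg derivative ih
    simp only [derivative_mul, derivative_X_pow, derivative_one,
      derivative_C, derivative_X, derivative_ofNat, Nat.cast_ofNat, C_ofNat, map_mul, map_add,
      map_sub, map_one, ← Function.iterate_succ_apply'] at h2
    simp only [Nat.cast_add, Nat.cast_one, map_mul, map_add, map_sub, map_one, C_ofNat,
      Function.iterate_succ_apply'] at h2 ⊢
    linear_combination h2

theorem iterate_derivative_legendrePoly (l m : ℕ) :
    Polynomial.derivative^[m] (legendrePoly l) =
      Polynomial.C (1 / (2 ^ l * (l.factorial : ℝ))) *
        Polynomial.derivative^[m + l] ((Polynomial.X ^ 2 - 1) ^ l) := by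
  rw [legendrePoly, Polynomial.iterate_derivative_C_mul, ← Function.iterate_add_apply]

theorem iterate_derivative_legendrePoly_recurrence (l m : ℕ) (t : ℝ) :
    2 * ((m : ℝ) + 1) * t * (Polynomial.derivative^[m + 1] (legendrePoly l)).eval t
      - (1 - t ^ 2) * (Polynomial.derivative^[m + 2] (legendrePoly l)).eval t
      = (l + m + 1) * (l - m) * (Polynomial.derivative^[m] (legendrePoly l)).eval t := by
  -- Rodrigues' formula already contains l derivatives, so order m + l gives the coefficients 2(m+1)
  -- and (l+m+1)(l-m).
  have h := congrArg (Polynomial.eval t) (iterate_derivative_sq_sub_one_pow l (m + l))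
  simp only [iterate_derivative_legendrePoly, Polynomial.eval_mul, Polynomial.eval_add,
    Polynomial.eval_sub, Polynomial.eval_pow, Polynomial.eval_X, Polynomial.eval_one,
    Polynomial.eval_C, add_right_comm m _ l] at h ⊢
  push_cast at h
  linear_combination (1 / (2 ^ l * (l.factorial : ℝ))) * h

theorem iterate_derivative_legendrePoly_eq_zero {l m : ℕ} (h : l < m) :
    Polynomial.derivative^[m] (legendrePoly l) = 0 := by
  rw [iterate_derivative_legendrePoly, Polynomial.iterate_derivative_eq_zero, mul_zero]
  have h1 : ((Polynomial.X ^ 2 - 1 : Polynomial ℝ) ^ l).natDegree ≤ l * 2 :=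
    Polynomial.natDegree_pow_le_of_le l (by compute_degree)
  omega

/-- Near 1, (X² - 1)^l = (X - 1)^l (X + 1)^l, so its l-th derivative at 1 is l! · 2^l. -/
theorem eval_one_legendrePoly (l : ℕ) : (legendrePoly l).eval 1 = 1 := by
  have h := Polynomial.aeval_iterate_derivative_self ((Polynomial.X ^ 2 - 1 : Polynomial ℝ) ^ l) l
    (A := ℝ) (p' := (Polynomial.X + 1) ^ l) (r := 1) (by
      rw [Algebra.algebraMap_self, Polynomial.map_id, ← mul_pow, Polynomial.C_1]; congr 1; ring)
  rw [Polynomial.coe_aeval_eq_eval] at h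
  rw [legendrePoly, Polynomial.eval_mul, Polynomial.eval_C, h]
  have := Nat.factorial_ne_zero l
  simp only [nsmul_eq_mul, Polynomial.eval_pow, Polynomial.eval_add, Polynomial.eval_X,
    Polynomial.eval_one]
  field_simp
  norm_num

/-! ### Ladder relations in m at spin weight zero -/

/-- The coefficient `√((l - m)(l + m + 1))` of the ladder operators in the order `m`. -/
def ladderCoeff (l : ℕ) (m : ℤ) : ℝ := √((l : ℝ) * (l + 1) - m * (m + 1))

/-- The normalization factor of `Y_l^k`. -/
def harmonicNorm (l k : ℕ) : ℝ :=
  √((2 * (l : ℝ) + 1) / (4 * Real.pi) * ((l - k).factorial / (l + k).factorial))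

/-- The modulus part `N_l^k sin^k ϑ P_l^{(k)}(cos ϑ)` of `Y_l^k`. -/
def harmonicProfile (l k : ℕ) (ϑ : ℝ) : ℝ :=
  harmonicNorm l k *
    (Real.sin ϑ ^ k * (Polynomial.derivative^[k] (legendrePoly l)).eval (Real.cos ϑ))

/-- The `ϑ`-dependence of the spherical harmonics, with signs such that the ladder relations in
`m` take the same form for all `m`. -/
def ladderProfile (l : ℕ) : ℤ → ℝ → ℝ
  | .ofNat k, ϑ => (-1) ^ k * harmonicProfile l k ϑ
  | .negSucc k, ϑ => harmonicProfile l (k + 1) ϑ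

theorem ladderCoeff_self (l : ℕ) : ladderCoeff l l = 0 := by
  simp [ladderCoeff]

theorem ladderCoeff_neg (l : ℕ) (m : ℤ) : ladderCoeff l (-m - 1) = ladderCoeff l m := by
  rw [ladderCoeff, ladderCoeff]; congr 1; push_cast; ring

theorem ladderCoeff_sq {l : ℕ} {m : ℤ} (h1 : -l - 1 ≤ m) (h2 : m ≤ l) :
    ladderCoeff l m ^ 2 = (l : ℝ) * (l + 1) - m * (m + 1) := by
  refine Real.sq_sqrt ?_
  have h3 : (-l - 1 : ℝ) ≤ m := by exact_mod_cast h1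
  have h4 : (m : ℝ) ≤ l := by exact_mod_cast h2
  nlinarith

theorem harmonicNorm_eq {l k : ℕ} (h : k < l) :
    harmonicNorm l k = ladderCoeff l k * harmonicNorm l (k + 1) := by
  obtain ⟨d, rfl⟩ := Nat.exists_eq_add_of_lt h
  rw [harmonicNorm, harmonicNorm, ladderCoeff, ← Real.sqrt_mul]
  · congr 1
    rw [show k + d + 1 - k = d + 1 by omega, show k + d + 1 - (k + 1) = d by omega,
      show k + d + 1 + (k + 1) = (k + d + 1 + k) + 1 by ring, Nat.factorial_succ,
      Nat.factorial_succ (_ + k)]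
    have := Nat.factorial_ne_zero (k + d + 1 + k)
    push_cast
    field_simp
    ring
  · push_cast
    have : (0 : ℝ) ≤ d := d.cast_nonneg
    have : (0 : ℝ) ≤ k := k.cast_nonneg
    nlinarith [mul_nonneg ‹(0 : ℝ) ≤ d› ‹(0 : ℝ) ≤ k›]

theorem harmonicProfile_eq_zero {l k : ℕ} (h : l < k) (ϑ : ℝ) : harmonicProfile l k ϑ = 0 := by
  simp [harmonicProfile, iterate_derivative_legendrePoly_eq_zero h]

/-- The derivative factor vanishes for k ≥ l, which removes the restriction k < l needed in
`harmonicNorm_eq`. -/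
theorem harmonicNorm_mul_eval (l k : ℕ) (t : ℝ) :
    harmonicNorm l k * (Polynomial.derivative^[k + 1] (legendrePoly l)).eval t
      = ladderCoeff l k * harmonicNorm l (k + 1)
        * (Polynomial.derivative^[k + 1] (legendrePoly l)).eval t := by
  rcases lt_or_ge k l with h | h
  · rw [harmonicNorm_eq h]
  · simp [iterate_derivative_legendrePoly_eq_zero (show l < k + 1 by omega)]

theorem hasDerivAt_harmonicProfile (l k : ℕ) {ϑ : ℝ} (hϑ : Real.sin ϑ ≠ 0) :
    HasDerivAt (harmonicProfile l k) (k * Real.cot ϑ * harmonicProfile l k ϑ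
      - ladderCoeff l k * harmonicProfile l (k + 1) ϑ) ϑ := by
  have h1 := (((Real.hasDerivAt_sin ϑ).pow k).mul
    (((Polynomial.derivative^[k] (legendrePoly l)).hasDerivAt (Real.cos ϑ)).comp ϑ
      (Real.hasDerivAt_cos ϑ))).const_mul (harmonicNorm l k)
  refine h1.congr_deriv ?_
  have h2 := harmonicNorm_mul_eval l k (Real.cos ϑ)
  rw [← Function.iterate_succ_apply' (Polynomial.derivative (R := ℝ))]
  have h3 : (k : ℝ) * Real.sin ϑ ^ k = k * Real.sin ϑ ^ (k - 1) * Real.sin ϑ := by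
    rcases k with _ | k <;> simp [pow_succ, mul_assoc]
  simp only [harmonicProfile, Real.cot_eq_cos_div_sin, Function.comp, Pi.pow_apply]
  rw [show (k : ℝ) * (Real.cos ϑ / Real.sin ϑ) * (harmonicNorm l k * (Real.sin ϑ ^ k *
    (Polynomial.derivative^[k] (legendrePoly l)).eval (Real.cos ϑ))) =
    (k * Real.sin ϑ ^ k) * (Real.cos ϑ / Real.sin ϑ) * (harmonicNorm l k *
    (Polynomial.derivative^[k] (legendrePoly l)).eval (Real.cos ϑ)) by ring, h3]
  field_simp
  linear_combination (-Real.sin ϑ ^ k * Real.sin ϑ) * h2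

/-- This is the m-times differentiated Legendre equation, with powers of sin ϑ and the norms
absorbed into the profiles. -/
theorem harmonicProfile_recurrence (l k : ℕ) {ϑ : ℝ} (hϑ : Real.sin ϑ ≠ 0) :
    2 * ((k : ℝ) + 1) * Real.cot ϑ * harmonicProfile l (k + 1) ϑ
      = ladderCoeff l (k + 1 : ℕ) * harmonicProfile l (k + 2) ϑ
        + ladderCoeff l k * harmonicProfile l k ϑ := by
  rcases lt_or_ge k l with h | h
  · have h1 := iterate_derivative_legendrePoly_recurrence l k (Real.cos ϑ)
    have h2 := harmonicNorm_mul_eval l (k + 1) (Real.cos ϑ)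
    have h3 := ladderCoeff_sq (l := l) (m := k) (by omega) (by omega)
    have h4 := Real.sin_sq ϑ
    simp only [harmonicProfile, Real.cot_eq_cos_div_sin]
    rw [harmonicNorm_eq h]
    simp only [Int.cast_natCast] at h3
    field_simp
    simp only [add_assoc, one_add_one_eq_two] at h1 h2 ⊢
    rw [← h4] at h1
    linear_combination Real.sin ϑ ^ (k + 1) * harmonicNorm l (k + 1) * h1
      + Real.sin ϑ ^ (k + 3) * h2 - Real.sin ϑ ^ (k + 1) * harmonicNorm l (k + 1) *
        (Polynomial.derivative^[k] (legendrePoly l)).eval (Real.cos ϑ) * h3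
  · rw [harmonicProfile_eq_zero (show l < k + 1 by omega),
      harmonicProfile_eq_zero (show l < k + 2 by omega)]
    rcases eq_or_lt_of_le h with rfl | h
    · rw [ladderCoeff_self]; ring
    · rw [harmonicProfile_eq_zero h]; ring

theorem ladderProfile_natCast (l k : ℕ) (ϑ : ℝ) :
    ladderProfile l k ϑ = (-1) ^ k * harmonicProfile l k ϑ := rfl

theorem ladderProfile_neg_natCast (l k : ℕ) (ϑ : ℝ) :
    ladderProfile l (-(k : ℤ)) ϑ = harmonicProfile l k ϑ := by
  rcases k with _ | k
  · simpa using ladderProfile_natCast l 0 ϑ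
  · rfl

theorem ladderProfile_relation (l : ℕ) (m : ℤ) {ϑ : ℝ} (hϑ : Real.sin ϑ ≠ 0) :
    ladderCoeff l m * ladderProfile l (m + 1) ϑ
      + ladderCoeff l (m - 1) * ladderProfile l (m - 1) ϑ
      = -2 * (m * Real.cot ϑ) * ladderProfile l m ϑ := by
  obtain ⟨k, rfl | rfl⟩ := m.eq_nat_or_neg <;> rcases k with _ | k
  · have h1 := ladderProfile_natCast l 1 ϑ
    have h2 := ladderProfile_neg_natCast l 1 ϑ
    have h3 := ladderCoeff_neg l 0
    simp only [Nat.cast_one, Nat.cast_zero, zero_sub, neg_zero, zero_add] at *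
    rw [h1, h2, h3]
    simp
  · have h := harmonicProfile_recurrence l k hϑ
    rw [show ((k + 1 : ℕ) : ℤ) + 1 = (k + 2 : ℕ) by push_cast; ring,
      show ((k + 1 : ℕ) : ℤ) - 1 = k by push_cast; ring]
    simp only [ladderProfile_natCast]
    push_cast at h ⊢
    linear_combination -(-1) ^ k * h
  · have h1 := ladderProfile_natCast l 1 ϑ
    have h2 := ladderProfile_neg_natCast l 1 ϑ
    have h3 := ladderCoeff_neg l 0
    simp only [Nat.cast_one, Nat.cast_zero, zero_sub, neg_zero, zero_add] at *
    rw [h1, h2, h3]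
    simp
  · have h := harmonicProfile_recurrence l k hϑ
    have h1 := ladderCoeff_neg l k
    have h2 := ladderCoeff_neg l (k + 1 : ℕ)
    have h3 := ladderProfile_neg_natCast l k ϑ
    have h4 := ladderProfile_neg_natCast l (k + 1) ϑ
    have h5 := ladderProfile_neg_natCast l (k + 2) ϑ
    rw [h2, show -((k + 1 : ℕ) : ℤ) + 1 = -(k : ℤ) by push_cast; ring,
      show -((k + 1 : ℕ) : ℤ) - 1 = -((k + 2 : ℕ) : ℤ) by push_cast; ring, h3, h4, h5,
      show -((k + 1 : ℕ) : ℤ) = -(k : ℤ) - 1 by push_cast; ring, h1]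
    push_cast at h ⊢
    linear_combination -h

/-- `hasDerivAt_harmonicProfile` involves one neighbour and a cot term; half of
`ladderProfile_relation` trades the cot term for the other neighbour. -/
theorem hasDerivAt_ladderProfile (l : ℕ) (m : ℤ) {ϑ : ℝ} (hϑ : Real.sin ϑ ≠ 0) :
    HasDerivAt (ladderProfile l m) ((ladderCoeff l m * ladderProfile l (m + 1) ϑ
      - ladderCoeff l (m - 1) * ladderProfile l (m - 1) ϑ) / 2) ϑ := by
  have hR := ladderProfile_relation l m hϑ
  obtain ⟨k, rfl | rfl⟩ := m.eq_nat_or_neg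
  · have h := (hasDerivAt_harmonicProfile l k hϑ).const_mul ((-1) ^ k)
    refine (h.congr_deriv ?_ : HasDerivAt (ladderProfile l k) _ ϑ)
    have h1 := ladderProfile_natCast l (k + 1) ϑ
    have h2 := ladderProfile_natCast l k ϑ
    push_cast at *
    rw [h2, h1] at hR
    rw [h1]
    linear_combination (1 / 2) * hR
  · have h := hasDerivAt_harmonicProfile l k hϑ
    rw [← funext (ladderProfile_neg_natCast l k)] at h
    refine h.congr_deriv ?_
    have h1 := ladderProfile_neg_natCast l (k + 1) ϑ
    have h3 := ladderCoeff_neg l k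
    push_cast at *
    rw [neg_add, ← sub_eq_add_neg] at h1
    rw [h1, h3] at hR
    rw [h1, h3]
    linear_combination (-1 / 2) * hR

/-! ### Ladder relations at higher spin weight -/

/-- The `ϑ`-dependence of `ð^n Y_l^m`, up to the sign convention of `ladderProfile`. -/
def spinProfile (l : ℕ) : ℕ → ℤ → ℝ → ℝ
  | 0, m, ϑ => ladderProfile l m ϑ
  | n + 1, m, ϑ =>
    -- The first term stands for -∂_ϑ, written through the neighbours m ± 1 so that the recursion is
    -- algebraic.
    -((ladderCoeff l m * spinProfile l n (m + 1) ϑ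
        - ladderCoeff l (m - 1) * spinProfile l n (m - 1) ϑ) / 2)
      + (m / Real.sin ϑ + n * Real.cot ϑ) * spinProfile l n m ϑ

theorem hasDerivAt_inv_sin {ϑ : ℝ} (hϑ : Real.sin ϑ ≠ 0) :
    HasDerivAt (fun t => (Real.sin t)⁻¹) (-(Real.cos ϑ / Real.sin ϑ ^ 2)) ϑ :=
  ((Real.hasDerivAt_sin ϑ).inv hϑ).congr_deriv (by ring)

theorem hasDerivAt_cot {ϑ : ℝ} (hϑ : Real.sin ϑ ≠ 0) :
    HasDerivAt Real.cot (-(1 / Real.sin ϑ ^ 2)) ϑ := by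
  rw [funext Real.cot_eq_cos_div_sin]
  refine ((Real.hasDerivAt_cos ϑ).div (Real.hasDerivAt_sin ϑ) hϑ).congr_deriv ?_
  rw [← Real.sin_sq_add_cos_sq ϑ]
  ring

/-- The ladder relations in the order `m` persist under the spin-raising operator. -/
theorem spinProfile_ladder (l n : ℕ) (m : ℤ) {ϑ : ℝ} (hϑ : ϑ ∈ Set.Ioo 0 Real.pi) :
    HasDerivAt (spinProfile l n m) ((ladderCoeff l m * spinProfile l n (m + 1) ϑ
      - ladderCoeff l (m - 1) * spinProfile l n (m - 1) ϑ) / 2) ϑ ∧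
    ladderCoeff l m * spinProfile l n (m + 1) ϑ
      + ladderCoeff l (m - 1) * spinProfile l n (m - 1) ϑ
      = -2 * (m * Real.cot ϑ + n / Real.sin ϑ) * spinProfile l n m ϑ := by
  have hs (t : ℝ) (ht : t ∈ Set.Ioo 0 Real.pi) : Real.sin t ≠ 0 :=
    (Real.sin_pos_of_mem_Ioo ht).ne'
  induction n generalizing m ϑ with
  | zero =>
    refine ⟨hasDerivAt_ladderProfile l m (hs _ hϑ), ?_⟩
    simpa [spinProfile] using ladderProfile_relation l m (hs _ hϑ)
  | succ n ih =>
    have h0 := hs _ hϑ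
    have hd (k : ℤ) := (ih k hϑ).1
    have hR := (ih m hϑ).2
    -- The ϑ-derivative of the algebraic relation `hR`, which holds on a neighbourhood of ϑ.
    have hdR : (ladderCoeff l m * ((ladderCoeff l (m + 1) * spinProfile l n (m + 1 + 1) ϑ
          - ladderCoeff l (m + 1 - 1) * spinProfile l n (m + 1 - 1) ϑ) / 2)
        + ladderCoeff l (m - 1) * ((ladderCoeff l (m - 1) * spinProfile l n (m - 1 + 1) ϑ
          - ladderCoeff l (m - 1 - 1) * spinProfile l n (m - 1 - 1) ϑ) / 2))
        = -2 * ((m * -(1 / Real.sin ϑ ^ 2) + n * -(Real.cos ϑ / Real.sin ϑ ^ 2))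
            * spinProfile l n m ϑ + (m * Real.cot ϑ + n / Real.sin ϑ) *
          ((ladderCoeff l m * spinProfile l n (m + 1) ϑ
            - ladderCoeff l (m - 1) * spinProfile l n (m - 1) ϑ) / 2)) := by
      have h1 := ((hd (m + 1)).const_mul (ladderCoeff l m)).add
        ((hd (m - 1)).const_mul (ladderCoeff l (m - 1)))
      have h2 := ((((hasDerivAt_cot h0).const_mul (m : ℝ)).add
        ((hasDerivAt_inv_sin h0).const_mul (n : ℝ))).mul (hd m)).const_mul (-2)
      refine h1.unique ((h2.congr_of_eventuallyEq ?_).congr_deriv ?_)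
      · filter_upwards [isOpen_Ioo.mem_nhds hϑ] with t ht
        simpa [div_eq_mul_inv, mul_assoc] using (ih m ht).2
      · simp only [Pi.add_apply, div_eq_mul_inv]
    have h1 := ((((hd (m + 1)).const_mul (ladderCoeff l m)).sub
        ((hd (m - 1)).const_mul (ladderCoeff l (m - 1)))).div_const 2).neg
    have h2 := (((hasDerivAt_inv_sin h0).const_mul (m : ℝ)).add
        ((hasDerivAt_cot h0).const_mul (n : ℝ))).mul (hd m)
    constructor
    · refine (h1.add h2).congr_deriv ?_
      simp only [spinProfile, Real.cot_eq_cos_div_sin, add_sub_cancel_right, sub_add_cancel,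
        Pi.add_apply] at hR ⊢
      push_cast
      -- Passing to m ± 1 changes the weight m / sin ϑ + n cot ϑ by ±1 / sin ϑ; by `hR` the
      -- resulting terms equal the derivative of the weight times p_m.
      linear_combination (-(1 / (2 * Real.sin ϑ))) * hR
    · simp only [spinProfile, Real.cot_eq_cos_div_sin, add_sub_cancel_right,
        sub_add_cancel] at hR hdR ⊢
      push_cast
      linear_combination
        -hdR + (m / Real.sin ϑ + n * (Real.cos ϑ / Real.sin ϑ)) * hR

/-! ### Diagonal sums over m -/

theorem sum_Icc_shift (l : ℕ) (F : ℤ → ℝ) (h1 : F l = 0) (h2 : F (-l - 1) = 0) :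
    ∑ m ∈ Finset.Icc (-(l : ℤ)) l, F (m - 1) = ∑ m ∈ Finset.Icc (-(l : ℤ)) l, F m := by
  have h3 : ∑ m ∈ Finset.Icc (-(l : ℤ)) l, F (m - 1)
      = ∑ m ∈ Finset.Icc (-(l : ℤ) - 1) (l - 1), F m :=
    Finset.sum_bij' (fun m _ => m - 1) (fun m _ => m + 1)
      (fun m hm => by simp only [Finset.mem_Icc] at *; omega)
      (fun m hm => by simp only [Finset.mem_Icc] at *; omega)
      (fun m _ => by simp) (fun m _ => by simp) (fun m _ => rfl)
  have h4 : ∑ m ∈ Finset.Icc (-(l : ℤ) - 1) (l - 1), F m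
      = ∑ m ∈ Finset.Icc (-(l : ℤ) - 1) l, F m := by
    refine Finset.sum_subset (Finset.Icc_subset_Icc_right (by omega)) fun m hm hm' => ?_
    simp only [Finset.mem_Icc] at hm hm'
    rw [show m = l by omega, h1]
  have h5 : ∑ m ∈ Finset.Icc (-(l : ℤ)) l, F m = ∑ m ∈ Finset.Icc (-(l : ℤ) - 1) l, F m := by
    refine Finset.sum_subset (Finset.Icc_subset_Icc_left (by omega)) fun m hm hm' => ?_
    simp only [Finset.mem_Icc] at hm hm'
    rw [show m = -(l : ℤ) - 1 by omega, h2]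
  rw [h3, h4, h5]

theorem ladderCoeff_neg_self (l : ℕ) : ladderCoeff l (-l - 1) = 0 := by
  rw [ladderCoeff_neg, ladderCoeff_self]

/-- Summed over `m`, the squares of the derivatives and of the zeroth order terms of `ð` are
controlled by the Laplacian eigenvalue. -/
theorem sum_sq_deriv_add_sq_spinProfile (l n : ℕ) {ϑ : ℝ} (hϑ : ϑ ∈ Set.Ioo 0 Real.pi) :
    ∑ m ∈ Finset.Icc (-(l : ℤ)) l,
      (((ladderCoeff l m * spinProfile l n (m + 1) ϑ
        - ladderCoeff l (m - 1) * spinProfile l n (m - 1) ϑ) / 2) ^ 2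
        + ((m / Real.sin ϑ + n * Real.cot ϑ) * spinProfile l n m ϑ) ^ 2)
      = ((l : ℝ) * (l + 1) - n ^ 2) * ∑ m ∈ Finset.Icc (-(l : ℤ)) l, spinProfile l n m ϑ ^ 2 := by
  have h0 : Real.sin ϑ ≠ 0 := (Real.sin_pos_of_mem_Ioo hϑ).ne'
  -- Trades the weight in ð for the weight in the ladder relation.
  have hw (m : ℤ) : (m / Real.sin ϑ + n * Real.cot ϑ) ^ 2
      = (m * Real.cot ϑ + n / Real.sin ϑ) ^ 2 + m ^ 2 - n ^ 2 := by
    rw [Real.cot_eq_cos_div_sin]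
    field_simp
    linear_combination (m ^ 2 - n ^ 2 : ℝ) * -Real.sin_sq_add_cos_sq ϑ
  have h1 (m : ℤ) : ((ladderCoeff l m * spinProfile l n (m + 1) ϑ
        - ladderCoeff l (m - 1) * spinProfile l n (m - 1) ϑ) / 2) ^ 2
        + ((m / Real.sin ϑ + n * Real.cot ϑ) * spinProfile l n m ϑ) ^ 2
      = (ladderCoeff l m ^ 2 * spinProfile l n (m + 1) ϑ ^ 2) / 2
        + (ladderCoeff l (m - 1) ^ 2 * spinProfile l n (m - 1) ϑ ^ 2) / 2
        + (m ^ 2 - n ^ 2) * spinProfile l n m ϑ ^ 2 := by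
    have hR := (spinProfile_ladder l n m hϑ).2
    rw [mul_pow, hw]
    -- Cross terms cancel: ((a-b)/2)² + ((a+b)/2)² = (a² + b²)/2.
    have hR2 := congrArg (· ^ 2) hR
    linear_combination (-1 / 4) * hR2
  simp only [h1, Finset.sum_add_distrib, ← Finset.sum_div]
  have h2 := sum_Icc_shift l (fun m => ladderCoeff l m ^ 2 * spinProfile l n (m + 1) ϑ ^ 2)
    (by simp [ladderCoeff_self]) (by simp [ladderCoeff_neg_self])
  have h3 := sum_Icc_shift l (fun m => ladderCoeff l m ^ 2 * spinProfile l n m ϑ ^ 2)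
    (by simp [ladderCoeff_self]) (by simp [ladderCoeff_neg_self])
  simp only [sub_add_cancel] at h2
  rw [← h2, h3, Finset.sum_div, Finset.sum_div, ← Finset.sum_add_distrib,
    ← Finset.sum_add_distrib, Finset.mul_sum]
  refine Finset.sum_congr rfl fun m hm => ?_
  rw [Finset.mem_Icc] at hm
  have h4 := ladderCoeff_sq (l := l) (m := m) (by omega) (by omega)
  have h5 := ladderCoeff_sq (l := l) (m := m - 1) (by omega) (by omega)
  -- The average of the two squared coefficients is l(l+1) - m², so m² drops out.
  rw [h4, h5]
  push_cast
  ring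

theorem sum_sq_spinProfile_succ_le (l n : ℕ) {ϑ : ℝ} (hϑ : ϑ ∈ Set.Ioo 0 Real.pi) :
    ∑ m ∈ Finset.Icc (-(l : ℤ)) l, spinProfile l (n + 1) m ϑ ^ 2
      ≤ 2 * (((l : ℝ) * (l + 1) - n ^ 2) *
        ∑ m ∈ Finset.Icc (-(l : ℤ)) l, spinProfile l n m ϑ ^ 2) := by
  rw [← sum_sq_deriv_add_sq_spinProfile l n hϑ, Finset.mul_sum]
  refine Finset.sum_le_sum fun m _ => ?_
  simp only [spinProfile]
  exact (add_sq_le).trans_eq (by ring)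

theorem harmonicNorm_zero_sq (l : ℕ) : harmonicNorm l 0 ^ 2 = (2 * (l : ℝ) + 1) / (4 * Real.pi) := by
  have := Nat.factorial_ne_zero l
  rw [harmonicNorm, Real.sq_sqrt]
  · simp [this]
  · positivity

theorem continuous_harmonicProfile (l k : ℕ) : Continuous (harmonicProfile l k) := by
  have := (Polynomial.derivative^[k] (legendrePoly l)).continuous
  exact continuous_const.mul
    ((Real.continuous_sin.pow k).mul (this.comp Real.continuous_cos))

theorem continuous_ladderProfile (l : ℕ) (m : ℤ) : Continuous (ladderProfile l m) := by
  rcases m with k | k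
  · exact continuous_const.mul (continuous_harmonicProfile l k)
  · exact continuous_harmonicProfile l (k + 1)

theorem ladderProfile_at_zero (l : ℕ) (m : ℤ) :
    ladderProfile l m 0 = if m = 0 then harmonicNorm l 0 else 0 := by
  have h (k : ℕ) (hk : k ≠ 0) : harmonicProfile l k 0 = 0 := by simp [harmonicProfile, hk]
  rcases m with (_ | k) | k
  · simp [ladderProfile, harmonicProfile, eval_one_legendrePoly]
  · rw [if_neg (by simp; omega)]
    simp [ladderProfile, h]
  · simp [ladderProfile, h]

/-- The addition theorem on the diagonal for spin weight `0`. -/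
theorem sum_sq_ladderProfile (l : ℕ) {ϑ : ℝ} (hϑ : ϑ ∈ Set.Icc 0 Real.pi) :
    ∑ m ∈ Finset.Icc (-(l : ℤ)) l, ladderProfile l m ϑ ^ 2 = (2 * (l : ℝ) + 1) / (4 * Real.pi) := by
  have hc : Continuous fun t => ∑ m ∈ Finset.Icc (-(l : ℤ)) l, ladderProfile l m t ^ 2 :=
    continuous_finsetSum _ fun m _ => (continuous_ladderProfile l m).pow 2
  have hd (t : ℝ) (ht : t ∈ Set.Ioo 0 Real.pi) :
      HasDerivAt (fun t => ∑ m ∈ Finset.Icc (-(l : ℤ)) l, ladderProfile l m t ^ 2) 0 t := by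
    have h0 : Real.sin t ≠ 0 := (Real.sin_pos_of_mem_Ioo ht).ne'
    refine (HasDerivAt.fun_sum fun m _ => (hasDerivAt_ladderProfile l m h0).fun_pow 2).congr_deriv ?_
    -- The derivative of the sum telescopes, with vanishing ends.
    have h2 := sum_Icc_shift l
      (fun m => ladderCoeff l m * (ladderProfile l m t * ladderProfile l (m + 1) t))
      (by simp [ladderCoeff_self]) (by simp [ladderCoeff_neg_self])
    rw [← sub_eq_zero, ← Finset.sum_sub_distrib, ← neg_eq_zero, ← Finset.sum_neg_distrib] at h2
    rw [← h2]
    refine Finset.sum_congr rfl fun m _ => ?_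
    simp only [sub_add_cancel]
    ring
  have h0 : ∑ m ∈ Finset.Icc (-(l : ℤ)) l, ladderProfile l m 0 ^ 2
      = (2 * (l : ℝ) + 1) / (4 * Real.pi) := by
    simp [ladderProfile_at_zero, harmonicNorm_zero_sq]
  rcases hϑ.1.eq_or_lt with rfl | hpos
  · exact h0
  · obtain ⟨c, -, hc'⟩ := exists_hasDerivAt_eq_slope _ (fun _ => (0 : ℝ)) hpos hc.continuousOn
      fun t ht => hd t ⟨ht.1, ht.2.trans_le hϑ.2⟩
    rw [eq_comm, div_eq_zero_iff, sub_zero] at hc'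
    rw [← h0]
    exact sub_eq_zero.1 (hc'.resolve_right hpos.ne')

/-- The bound on the normalized diagonal sum, away from the poles. -/
theorem sum_sq_spinProfile_le {l n : ℕ} (hl : 1 ≤ l) (hn : n ≤ l) {ϑ : ℝ}
    (hϑ : ϑ ∈ Set.Ioo 0 Real.pi) :
    ((l - n).factorial / (l + n).factorial : ℝ) *
      ∑ m ∈ Finset.Icc (-(l : ℤ)) l, spinProfile l n m ϑ ^ 2 ≤ 4 ^ n * l := by
  have hl' : (1 : ℝ) ≤ l := by exact_mod_cast hl
  induction n with
  | zero =>
    have h1 := Nat.factorial_ne_zero l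
    simp only [spinProfile, sum_sq_ladderProfile l (Set.Ioo_subset_Icc_self hϑ)]
    rw [Nat.sub_zero, Nat.add_zero, div_self (by exact_mod_cast h1), one_mul, pow_zero, one_mul,
      div_le_iff₀ (by positivity)]
    nlinarith [Real.pi_gt_three]
  | succ n ih =>
    have ih := ih (by omega)
    obtain ⟨d, rfl⟩ := Nat.exists_eq_add_of_lt (show n < l by omega)
    have h1 := sum_sq_spinProfile_succ_le (n + d + 1) n hϑ
    set S := ∑ m ∈ Finset.Icc (-((n + d + 1 : ℕ) : ℤ)) (n + d + 1 : ℕ),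
      spinProfile (n + d + 1) n m ϑ ^ 2
    have hS : 0 ≤ S := Finset.sum_nonneg fun m _ => sq_nonneg _
    rw [show n + d + 1 - n = d + 1 by omega, show n + d + 1 + n = 2 * n + d + 1 by ring,
      Nat.factorial_succ d] at ih
    rw [show n + d + 1 - (n + 1) = d by omega,
      show n + d + 1 + (n + 1) = (2 * n + d + 1) + 1 by ring, Nat.factorial_succ (_ + 1)]
    -- With d = l - n - 1 this is l(l+1) - n² ≤ 2(l-n)(l+n+1).
    have h2 : 2 * ((((n + d + 1 : ℕ) : ℝ) * ((n + d + 1 : ℕ) + 1) - n ^ 2) * S)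
        ≤ 4 * (((d : ℝ) + 1) * (2 * n + d + 2) * S) := by
      push_cast
      have : 0 ≤ (2 * ((d : ℝ) + 1) * (2 * n + d + 2)
        - ((n + d + 1 : ℝ) * (n + d + 1 + 1) - n ^ 2)) * S := by
        refine mul_nonneg ?_ hS
        ring_nf
        positivity
      linarith
    refine (mul_le_mul_of_nonneg_left (h1.trans h2) (by positivity)).trans ?_
    refine Eq.trans_le ?_ ((mul_le_mul_of_nonneg_left ih (by norm_num : (0 : ℝ) ≤ 4)).trans_eq
      (by ring))
    have := Nat.factorial_ne_zero (2 * n + d + 1)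
    push_cast
    field_simp
    ring

/-- For l ≥ 2, 4 ≤ l²; for l = 1, n ≤ 1, and this case accounts for the factor 4. -/
theorem four_pow_mul_le {l n : ℕ} (hl : 1 ≤ l) (hn : n ≤ l) :
    (4 : ℝ) ^ n * l ≤ 4 * l ^ (2 * n + 1) := by
  have hl' : (1 : ℝ) ≤ l := by exact_mod_cast hl
  rw [pow_succ, pow_mul, ← mul_assoc]
  refine mul_le_mul_of_nonneg_right ?_ (by positivity)
  rcases hl.eq_or_lt with rfl | h
  · simpa using pow_le_pow_right₀ (by norm_num : (1 : ℝ) ≤ 4) hn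
  · have h2 : (2 : ℝ) ≤ l := by exact_mod_cast h
    have : (4 : ℝ) ^ n ≤ (l ^ 2) ^ n := pow_le_pow_left₀ (by norm_num) (by nlinarith) n
    have h3 : (0 : ℝ) ≤ (l ^ 2) ^ n := by positivity
    linarith

/-! ### Extension to the poles -/

/-- `spinProfile` extends continuously to the poles. -/
theorem exists_continuous_spinProfile {l n : ℕ} (hl : 1 ≤ l) (hn : n ≤ l) {m : ℤ}
    (hm : m ∈ Finset.Icc (-(l : ℤ)) l) :
    ∃ g : ℝ → ℝ, Continuous g ∧ Set.EqOn (spinProfile l n m) g (Set.Ioo 0 Real.pi) := by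
  obtain ⟨B, hB⟩ : ∃ B : ℝ, ∀ ϑ ∈ Set.Ioo 0 Real.pi,
      ((l : ℝ) * (l + 1) - n ^ 2) * ∑ m ∈ Finset.Icc (-(l : ℤ)) l, spinProfile l n m ϑ ^ 2
        ≤ B := by
    refine ⟨((l : ℝ) * (l + 1) - n ^ 2) * (4 ^ n * l / ((l - n).factorial / (l + n).factorial)),
      fun ϑ hϑ => mul_le_mul_of_nonneg_left ?_ ?_⟩
    · rw [le_div_iff₀ (by positivity), mul_comm]
      exact sum_sq_spinProfile_le hl hn hϑ
    · have : (n : ℝ) ≤ l := by exact_mod_cast hn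
      nlinarith [n.cast_nonneg (α := ℝ)]
  -- The squared derivative is one summand of a sum bounded by B, so the profile is √B-Lipschitz and
  -- extends.
  obtain ⟨g, hg, hg'⟩ := ((convex_Ioo 0 Real.pi).lipschitzOnWith_of_nnnorm_hasDerivWithin_le
    (C := (√B).toNNReal)
    (fun ϑ hϑ => (spinProfile_ladder l n m hϑ).1.hasDerivWithinAt) fun ϑ hϑ => by
      rw [← NNReal.coe_le_coe, Real.coe_toNNReal _ (Real.sqrt_nonneg _), coe_nnnorm,
        Real.norm_eq_abs]
      refine Real.abs_le_sqrt (le_trans ?_ (hB ϑ hϑ))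
      rw [← sum_sq_deriv_add_sq_spinProfile l n hϑ]
      refine le_trans ?_ (Finset.single_le_sum (fun k _ => ?_) hm)
      · exact le_add_of_nonneg_right (sq_nonneg _)
      · positivity).extend_real
  exact ⟨g, hg.continuous, hg'⟩

/-! ### From profiles to spin weighted harmonics -/

/-- The sign by which `Y_l^m` differs from the convention of `ladderProfile`. -/
def harmonicSign (m : ℤ) : ℝ := if 0 ≤ m then 1 else (-1) ^ m.natAbs

theorem abs_harmonicSign (m : ℤ) : |harmonicSign m| = 1 := by
  rw [harmonicSign]; split_ifs <;> simp

theorem sphericalHarmonic_eq (l : ℕ) (m : ℤ) {ϑ : ℝ} (hϑ : ϑ ∈ Set.Ioo 0 Real.pi) (φ : ℝ) :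
    sphericalHarmonic l m ϑ φ
      = ((harmonicSign m * ladderProfile l m ϑ : ℝ) : ℂ) * Complex.exp (Complex.I * m * φ) := by
  have hs : Real.sqrt (1 - Real.cos ϑ ^ 2) = Real.sin ϑ := by
    rw [← Real.sin_sq, Real.sqrt_sq (Real.sin_pos_of_mem_Ioo hϑ).le]
  obtain ⟨k, rfl | rfl⟩ := m.eq_nat_or_neg
  · rw [sphericalHarmonic, if_pos (by positivity), harmonicSign, if_pos (by positivity),
      ladderProfile_natCast, sphericalHarmonicNonneg, assocLegendre, hs, harmonicProfile,
      harmonicNorm, Int.toNat_natCast]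
    push_cast
    ring
  · rcases k with _ | k
    · have := ladderProfile_natCast l 0 ϑ
      simp only [Nat.cast_zero, neg_zero] at this ⊢
      rw [this]
      simp [sphericalHarmonic, harmonicSign, sphericalHarmonicNonneg, assocLegendre,
        harmonicProfile, harmonicNorm]
    · rw [sphericalHarmonic, if_neg (by push_cast; omega), harmonicSign,
        if_neg (by push_cast; omega), ladderProfile_neg_natCast, sphericalHarmonicNonneg,
        assocLegendre, hs, harmonicProfile, harmonicNorm, neg_neg, Int.toNat_natCast,
        Int.natAbs_neg, Int.natAbs_natCast]
      simp only [map_mul, map_pow, map_neg, map_one, Complex.conj_ofReal, ← Complex.exp_conj,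
        Complex.conj_I, map_natCast]
      push_cast
      ring_nf

theorem conj_sphericalHarmonic (l : ℕ) (m : ℤ) (ϑ φ : ℝ) :
    conj (sphericalHarmonic l m ϑ φ) = sphericalHarmonic l (-m) ϑ φ := by
  rcases lt_trichotomy m 0 with h | rfl | h
  · rw [sphericalHarmonic, sphericalHarmonic, if_neg h.not_ge, if_pos (by omega),
      Complex.conj_conj]
  · simp [sphericalHarmonic, sphericalHarmonicNonneg]
  · rw [sphericalHarmonic, sphericalHarmonic, if_pos h.le, if_neg (by omega), neg_neg]

theorem deriv_conj_comp (f : ℝ → ℂ) (t : ℝ) :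
    deriv (fun u => conj (f u)) t = conj (deriv f t) :=
  deriv.star

/-- Conjugation turns ð at weight s into ð̄ at weight -s. -/
theorem ethBarPow_eq_conj (n : ℕ) (f : ℝ → ℝ → ℂ) (ϑ φ : ℝ) :
    ethBarPow n f ϑ φ = conj (ethPow n (fun t p => conj (f t p)) ϑ φ) := by
  induction n generalizing ϑ φ with
  | zero => simp [ethBarPow, ethPow]
  | succ n ih =>
    have ih' : ethBarPow n f = fun t p => conj (ethPow n (fun t p => conj (f t p)) t p) :=
      funext fun t => funext fun p => ih t p
    rw [ethBarPow, ethPow, ethBar, eth, ih']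
    simp only [deriv_conj_comp, map_neg, map_add, map_sub, map_mul, map_div₀, Complex.conj_I,
      Complex.conj_ofReal, map_intCast]
    push_cast
    ring

theorem ethPow_sphericalHarmonic (l n : ℕ) (m : ℤ) {ϑ : ℝ} (hϑ : ϑ ∈ Set.Ioo 0 Real.pi) (φ : ℝ) :
    ethPow n (sphericalHarmonic l m) ϑ φ
      = ((harmonicSign m * spinProfile l n m ϑ : ℝ) : ℂ) * Complex.exp (Complex.I * m * φ) := by
  induction n generalizing ϑ φ with
  | zero => exact sphericalHarmonic_eq l m hϑ φ
  | succ n ih =>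
    have h1 : HasDerivAt (fun t => ethPow n (sphericalHarmonic l m) t φ) _ ϑ :=
      ((((spinProfile_ladder l n m hϑ).1.const_mul (harmonicSign m)).ofReal_comp).mul_const
        (Complex.exp (Complex.I * m * φ))).congr_of_eventuallyEq (by
          filter_upwards [isOpen_Ioo.mem_nhds hϑ] with t ht
          exact ih ht φ)
    have h2 : HasDerivAt (fun p => ethPow n (sphericalHarmonic l m) ϑ p)
        (((harmonicSign m * spinProfile l n m ϑ : ℝ) : ℂ) *
          (Complex.exp (Complex.I * m * φ) * (Complex.I * m))) φ := by
      rw [funext (ih hϑ)]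
      refine (HasDerivAt.cexp ?_).const_mul _
      simpa using (Complex.ofRealCLM.hasDerivAt (x := φ)).const_mul (Complex.I * m)
    rw [ethPow, eth, h1.deriv, h2.deriv, ih hϑ φ, spinProfile]
    push_cast
    linear_combination -(harmonicSign m * spinProfile l n m ϑ * m / Complex.sin ϑ
      * Complex.exp (Complex.I * m * φ)) * Complex.I_sq

/-- Along a meridian, `ₛY_l^m` is a constant multiple of the profile of order `m` (for `s ≥ 0`) or
`-m` (for `s < 0`). -/
theorem spinHarmonicInterior_eq (s : ℤ) (l : ℕ) (m : ℤ) (φ : ℝ) :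
    ∃ c : ℂ, ‖c‖ = √((l - s.natAbs).factorial / (l + s.natAbs).factorial) ∧
      ∀ ϑ ∈ Set.Ioo 0 Real.pi, spinHarmonicInterior s l m ϑ φ
        = c * (spinProfile l s.natAbs (if 0 ≤ s then m else -m) ϑ : ℂ) := by
  have hexp (k : ℤ) : ‖Complex.exp (Complex.I * k * φ)‖ = 1 := by
    rw [show Complex.I * k * φ = ((k * φ : ℝ) : ℂ) * Complex.I by push_cast; ring,
      Complex.norm_exp_ofReal_mul_I]
  have hnorm (k : ℤ) : ‖((√((l - s.natAbs).factorial / (l + s.natAbs).factorial) : ℝ) : ℂ)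
      * (harmonicSign k * Complex.exp (Complex.I * k * φ))‖
      = √((l - s.natAbs).factorial / (l + s.natAbs).factorial) := by
    rw [norm_mul, norm_mul, hexp, Complex.norm_real, Complex.norm_real, Real.norm_eq_abs,
      Real.norm_eq_abs, abs_harmonicSign, abs_of_nonneg (Real.sqrt_nonneg _), mul_one, mul_one]
  by_cases h : 0 ≤ s
  · have hs : s.toNat = s.natAbs := by omega
    refine ⟨_, hnorm m, fun ϑ hϑ => ?_⟩
    rw [spinHarmonicInterior, if_pos h, if_pos h, hs, ethPow_sphericalHarmonic l _ m hϑ]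
    push_cast
    ring
  · have hs : (-s).toNat = s.natAbs := by omega
    refine ⟨(-1) ^ s.natAbs * conj (((√((l - s.natAbs).factorial / (l + s.natAbs).factorial)
      : ℝ) : ℂ) * (harmonicSign (-m) * Complex.exp (Complex.I * (-m : ℤ) * φ))), ?_,
      fun ϑ hϑ => ?_⟩
    · rw [norm_mul, RCLike.norm_conj, hnorm, norm_pow, norm_neg, norm_one, one_pow, one_mul]
    · rw [spinHarmonicInterior, if_neg h, if_neg h, hs, ethBarPow_eq_conj]
      simp only [conj_sphericalHarmonic]
      rw [show (fun t p => sphericalHarmonic l (-m) t p) = sphericalHarmonic l (-m) from rfl,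
        ethPow_sphericalHarmonic l _ (-m) hϑ]
      simp only [map_mul, Complex.conj_ofReal, Complex.ofReal_mul]
      ring

theorem spinHarmonic_eq_of_continuous {s : ℤ} {l : ℕ} {m : ℤ} {x : ℝ × ℝ}
    (hx : x.1 ∈ Set.Icc 0 Real.pi) {u : ℝ → ℂ} (hu : Continuous u)
    (h : ∀ ϑ ∈ Set.Ioo 0 Real.pi, spinHarmonicInterior s l m ϑ x.2 = u ϑ) :
    spinHarmonic s l m x = u x.1 := by
  rw [spinHarmonic]
  split_ifs with hx'
  · exact h _ hx'
  · refine extendFrom_eq (by rwa [closure_Ioo Real.pi_ne_zero.symm]) ?_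
    refine (hu.continuousWithinAt (s := Set.Ioo 0 Real.pi)).tendsto.congr' ?_
    filter_upwards [self_mem_nhdsWithin] with t ht
    exact (h t ht).symm

/-- The diagonal bound `ₛK_l(x, x) ≤ 4 l^{2|s|+1}`. -/
theorem sum_norm_sq_spinHarmonic_le {s : ℤ} {l : ℕ} (hs : s.natAbs ≤ l) (hl : 1 ≤ l)
    {x : ℝ × ℝ} (hx : x ∈ sphereCoords) :
    ∑ m ∈ Finset.Icc (-(l : ℤ)) l, ‖spinHarmonic s l m x‖ ^ 2
      ≤ 4 * (l : ℝ) ^ (2 * s.natAbs + 1) := by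
  have hx1 : x.1 ∈ Set.Icc 0 Real.pi := hx.1
  choose! g hg hg' using fun m (hm : m ∈ Finset.Icc (-(l : ℤ)) l) =>
    exists_continuous_spinProfile hl hs hm
  set r : ℝ := (l - s.natAbs).factorial / (l + s.natAbs).factorial with hr
  have hr0 : 0 ≤ r := by positivity
  have hmem (m : ℤ) (hm : m ∈ Finset.Icc (-(l : ℤ)) l) :
      (if 0 ≤ s then m else -m) ∈ Finset.Icc (-(l : ℤ)) l := by
    rw [Finset.mem_Icc] at *
    split_ifs <;> omega
  have h1 (m : ℤ) (hm : m ∈ Finset.Icc (-(l : ℤ)) l) :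
      ‖spinHarmonic s l m x‖ ^ 2 = r * g (if 0 ≤ s then m else -m) x.1 ^ 2 := by
    obtain ⟨c, hc, hc'⟩ := spinHarmonicInterior_eq s l m x.2
    have := hg _ (hmem m hm)
    rw [spinHarmonic_eq_of_continuous hx1
      (u := fun t => c * (g (if 0 ≤ s then m else -m) t : ℂ)) (by fun_prop)
      fun t ht => by rw [hc' t ht, hg' _ (hmem m hm) ht]]
    rw [norm_mul, hc, mul_pow, Real.sq_sqrt hr0, Complex.norm_real, Real.norm_eq_abs, sq_abs]
  have h2 : ∑ m ∈ Finset.Icc (-(l : ℤ)) l, g (if 0 ≤ s then m else -m) x.1 ^ 2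
      = ∑ m ∈ Finset.Icc (-(l : ℤ)) l, g m x.1 ^ 2 :=
    Finset.sum_bij' (fun m _ => if 0 ≤ s then m else -m) (fun m _ => if 0 ≤ s then m else -m)
      hmem hmem (fun m _ => by split_ifs <;> simp) (fun m _ => by split_ifs <;> simp)
      fun m _ => rfl
  rw [Finset.sum_congr rfl h1, ← Finset.mul_sum, h2]
  refine le_trans ?_ (four_pow_mul_le hl hs)
  have hcont : ContinuousOn (fun t => r * ∑ m ∈ Finset.Icc (-(l : ℤ)) l, g m t ^ 2)
      (closure (Set.Ioo 0 Real.pi)) :=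
    (continuous_const.mul (continuous_finsetSum _ fun m hm => (hg m hm).pow 2)).continuousOn
  -- The bound on the open interval passes to the poles by continuity.
  refine le_on_closure (fun t ht => ?_) hcont continuousOn_const
    (by rwa [closure_Ioo Real.pi_ne_zero.symm] : x.1 ∈ closure (Set.Ioo 0 Real.pi))
  refine le_trans (le_of_eq ?_) (sum_sq_spinProfile_le hl hs ht)
  rw [hr]
  congr 1
  exact Finset.sum_congr rfl fun m hm => by rw [hg' m hm ht]

end

theorem mainTheorem3 :
    ∃ C : ℝ, 0 < C ∧
      ∀ (s : ℤ) (l : ℕ), s.natAbs ≤ l → 1 ≤ l →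
        ∀ x ∈ sphereCoords, ∀ y ∈ sphereCoords,
          ‖spinKernel s l x y‖ ≤ C * (l : ℝ) ^ (2 * s.natAbs + 1) := by
  refine ⟨4, by norm_num, fun s l hs hl x hx y hy => ?_⟩
  have h1 := sum_norm_sq_spinHarmonic_le hs hl hx
  have h2 := sum_norm_sq_spinHarmonic_le hs hl hy
  have h3 : ‖spinKernel s l x y‖ ≤ ∑ m ∈ Finset.Icc (-(l : ℤ)) l,
      (‖spinHarmonic s l m x‖ ^ 2 + ‖spinHarmonic s l m y‖ ^ 2) / 2 := by
    refine norm_sum_le_of_le _ fun m _ => ?_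
    rw [norm_mul, RCLike.norm_conj]
    linarith [two_mul_le_add_sq ‖spinHarmonic s l m x‖ ‖spinHarmonic s l m y‖]
  rw [← Finset.sum_div, Finset.sum_add_distrib] at h3
  linarith
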